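/- Let $0<\omega\le 1$. For a unit vector $|\varphi\rangle\in\mathbb C^m\otimes\mathbb C^n$ with $\rho_A=\mathrm{tr}_B|\varphi\rangle\langle\varphi|$, put $$\mathfrak C_\omega(|\varphi\rangle)=\big(\mathrm{tr}(\rho_A^{\,\omega})-1\big)^{\omega},$$ and for a density operator $\rho$ on $\mathbb C^m\otimes\mathbb C^n$ put $$\mathfrak C_\omega(\rho)=\min_{\{p_i,|\varphi_i\rangle\}}\sum_i p_i\,\mathfrak C_\omega(|\varphi_i\rangle),$$ the minimum being over all finite pure-state decompositions $\rho=\sum_i p_i|\varphi_i\rangle\langle\varphi_i|$ ($p_i\ge 0$, $\sum_i p_i=1$). This is well defined: the minimum is attained, and $\mathfrak C_\omega(|\varphi\rangle\langle\varphi|)=\mathfrak C_\omega(|\varphi\rangle)$ for pure states. An LOCC protocol is a finite sequence of rounds in each of which one of the two parties performs a local measurement with finitely many Kraus operators $K_i$, $\sum_iK_i^\dagger K_i=I$ (possibly changing the dimension of the local system), and communicates the result, on which the rest of the protocol may depend; at the end, part of the classical record may be discarded. Such a protocol gives completely positive maps $\Lambda_j$, one for each value $j$ of the retained record, and the channel $\Lambda=\sum_j\Lambda_j$.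 Then, in all finite dimensions: (i) (Faithfulness) $\mathfrak C_\omega(\rho)\ge 0$ for every density operator $\rho$, and $\mathfrak C_\omega(\rho)=0$ if $\rho$ is separable, i.e. a finite convex combination of product states; if $\omega<1$, then $\mathfrak C_\omega(\rho)=0$ if and only if $\rho$ is separable. (ii) (Monotonicity) $\mathfrak C_\omega(\Lambda(\rho))\le\mathfrak C_\omega(\rho)$ for every density operator $\rho$ and every LOCC channel $\Lambda$. (iii) (Local unitary invariance) $\mathfrak C_\omega\big((U_A\otimes U_B)\rho(U_A\otimes U_B)^\dagger\big)=\mathfrak C_\omega(\rho)$ for all density operators $\rho$ and unitaries $U_A$, $U_B$. (iv) (Strong monotonicity) For every density operator $\rho$ and every LOCC protocol with maps $\Lambda_j$, writing $p_j=\mathrm{tr}\,\Lambda_j(\rho)$ and $\sigma_j=\Lambda_j(\rho)/p_j$, one has $\sum_{j:\,p_j>0}p_j\,\mathfrak C_\omega(\sigma_j)\le\mathfrak C_\omega(\rho)$. (v) (Convexity) $\mathfrak C_\omega\big(\sum_ip_i\rho_i\big)\le\sum_ip_i\,\mathfrak C_\omega(\rho_i)$ for all finite families of density operators $\rho_i$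 and weights $p_i\ge0$ with $\sum_ip_i=1$. -/

import Mathlib

open scoped ComplexOrder Kronecker

noncomputable section

namespace GConcurrence

/-- Operators on the bipartite space `ℂ^m ⊗ ℂ^n`, as matrices in the product basis. -/
abbrev Op (m n : ℕ) : Type := Matrix (Fin m × Fin n) (Fin m × Fin n) ℂ

/-- Vectors of `ℂ^m ⊗ ℂ^n`, by their coefficients in the product basis. -/
abbrev Vec (m n : ℕ) : Type := Fin m × Fin n → ℂ

/-- Density operators: positive semidefinite with trace one. -/
def IsDensity {α : Type*} [Fintype α] (ρ : Matrix α α ℂ) : Prop :=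
  ρ.PosSemidef ∧ ρ.trace = 1

/-- Unit vectors: `⟨φ|φ⟩ = 1`. -/
def IsUnitVec {m n : ℕ} (φ : Vec m n) : Prop :=
  star φ ⬝ᵥ φ = 1

/-- The rank-one operator `|φ⟩⟨φ|`. -/
def proj {m n : ℕ} (φ : Vec m n) : Op m n :=
  Matrix.vecMulVec φ (star φ)

/-- Partial trace over the second subsystem. -/
def traceB {m n : ℕ} (ρ : Op m n) : Matrix (Fin m) (Fin m) ℂ :=
  Matrix.of fun i i' => ∑ j, ρ (i, j) (i', j)

/-- The real power `M ^ s` of a Hermitian matrix `M`, by functional calculus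
(the eigenvalues are raised to the power `s`). -/
def matPow {m : ℕ} (M : Matrix (Fin m) (Fin m) ℂ) (s : ℝ) : Matrix (Fin m) (Fin m) ℂ :=
  cfc (fun x : ℝ => x ^ s) M

/-- The `G_ω`-concurrence of a pure state, `(tr (ρ_A ^ ω) - 1) ^ ω` with
`ρ_A = tr_B |φ⟩⟨φ|`. -/
def pureG (ω : ℝ) {m n : ℕ} (φ : Vec m n) : ℝ :=
  ((matPow (traceB (proj φ)) ω).trace.re - 1) ^ ω

/-- `ρ = ∑ i, p i |φ i⟩⟨φ i|` is a decomposition of `ρ` into pure states. -/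
structure IsPureDecomposition {m n N : ℕ} (ρ : Op m n) (p : Fin N → ℝ)
    (φ : Fin N → Vec m n) : Prop where
  nonneg : ∀ i, 0 ≤ p i
  sum_eq_one : ∑ i, p i = 1
  unit : ∀ i, IsUnitVec (φ i)
  eq_sum : ρ = ∑ i, (p i : ℂ) • proj (φ i)

/-- The averages `∑ i, p i * G_ω(φ i)` over all pure-state decompositions of `ρ`. -/
def roofValues (ω : ℝ) {m n : ℕ} (ρ : Op m n) : Set ℝ :=
  {x | ∃ (N : ℕ) (p : Fin N → ℝ) (φ : Fin N → Vec m n),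
    IsPureDecomposition ρ p φ ∧ x = ∑ i, p i * pureG ω (φ i)}

/-- The `G_ω`-concurrence of a mixed state: the convex roof of `pureG`. -/
def gConc (ω : ℝ) {m n : ℕ} (ρ : Op m n) : ℝ :=
  sInf (roofValues ω ρ)

/-- Separable states: finite convex combinations of product states. -/
def IsSeparable {m n : ℕ} (ρ : Op m n) : Prop :=
  ∃ (N : ℕ) (p : Fin N → ℝ) (σ : Fin N → Matrix (Fin m) (Fin m) ℂ)
    (τ : Fin N → Matrix (Fin n) (Fin n) ℂ),
    (∀ i, 0 ≤ p i) ∧ ∑ i, p i = 1 ∧ (∀ i, IsDensity (σ i)) ∧ (∀ i, IsDensity (τ i)) ∧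
    ρ = ∑ i, (p i : ℂ) • (σ i ⊗ₖ τ i)

/-- `LOCC ι m' n' m n` is the type of finite-round LOCC protocols from `ℂ^m ⊗ ℂ^n` to
`ℂ^m' ⊗ ℂ^n'` with final classical outcome in `ι`. In each round one party performs a local
measurement, given by Kraus operators `K i` with `∑ i, (K i)ᴴ * K i = 1` and possibly changing
the dimension of that party's system, and announces the result `i`; the rest of the protocol may
depend on `i`. When the protocol stops, an element of `ι` (a function of the measurement record)
is kept and the rest of the record is discarded. Local unitaries, ancillas, shared
randomness, partial traces and arbitrary local channels and instruments are particular cases. -/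
inductive LOCC (ι : Type*) (m' n' : ℕ) : ℕ → ℕ → Type _
  | finish (outcome : ι) : LOCC ι m' n' m' n'
  | alice {m n l k : ℕ} (K : Fin k → Matrix (Fin l) (Fin m) ℂ)
      (hK : ∑ i, (K i).conjTranspose * K i = 1)
      (next : Fin k → LOCC ι m' n' l n) : LOCC ι m' n' m n
  | bob {m n l k : ℕ} (K : Fin k → Matrix (Fin l) (Fin n) ℂ)
      (hK : ∑ i, (K i).conjTranspose * K i = 1)
      (next : Fin k → LOCC ι m' n' m l) : LOCC ι m' n' m n

namespace LOCC

variable {ι : Type*} [DecidableEq ι] {m' n' : ℕ}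

/-- The unnormalized final state `Λ_j(ρ)` for the outcome `j`. -/
def branch : {m n : ℕ} → LOCC ι m' n' m n → Op m n → ι → Op m' n'
  | _, _, finish o, ρ, j => if o = j then ρ else 0
  | _, n, alice K _ next, ρ, j =>
      ∑ i, (next i).branch
        ((K i ⊗ₖ (1 : Matrix (Fin n) (Fin n) ℂ)) * ρ *
          (K i ⊗ₖ (1 : Matrix (Fin n) (Fin n) ℂ)).conjTranspose) j
  | m, _, bob K _ next, ρ, j =>
      ∑ i, (next i).branch
        (((1 : Matrix (Fin m) (Fin m) ℂ) ⊗ₖ K i) * ρ *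
          ((1 : Matrix (Fin m) (Fin m) ℂ) ⊗ₖ K i).conjTranspose) j

/-- The LOCC channel `Λ(ρ) = ∑ j, Λ_j(ρ)`. -/
def channel [Fintype ι] {m n : ℕ} (P : LOCC ι m' n' m n) (ρ : Op m n) : Op m' n' :=
  ∑ j, P.branch ρ j

/-- The probability `p_j = tr Λ_j(ρ)` of the outcome `j`. -/
def prob {m n : ℕ} (P : LOCC ι m' n' m n) (ρ : Op m n) (j : ι) : ℝ :=
  (P.branch ρ j).trace.re

/-- The state `σ_j = Λ_j(ρ) / p_j` after the outcome `j` (meaningful if `p_j ≠ 0`). -/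
def post {m n : ℕ} (P : LOCC ι m' n' m n) (ρ : Op m n) (j : ι) : Op m' n' :=
  ((P.prob ρ j : ℂ)⁻¹) • P.branch ρ j

end LOCC

end GConcurrence

end

open GConcurrence

/-! Extend the pure-state formula homogeneously: `stateG ω A` is `t * (tr ((A/t) ^ ω) - 1) ^ ω` with
`t = tr A`. As `A ↦ tr (A ^ ω)` is concave and `x ↦ x ^ ω` is concave and increasing on `[0, ∞)`,
this functional is superadditive on positive semidefinite matrices (`stateG_add_le`).

A vector has a coefficient matrix `M`, with reduced state `M Mᴴ`. Alice's Kraus operators send `M`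
to `K i * M`, and the matrices `(K i * M)ᴴ * (K i * M)` sum to `Mᴴ M`. Since `M Mᴴ` and `Mᴴ M` have
the same nonzero spectrum, superadditivity shows that the total value over the outcomes does not
exceed the initial one; Bob's case is symmetric (`sum_vecG_alice_le`, `sum_vecG_bob_le`).

With weights absorbed into unnormalized vectors, the pairs (operator, upper bound for the value of
some decomposition) form an additive cone `roofCone`. One Kraus step splits an element of it into
elements whose bounds add up to no more; induction over the protocol gives both monotonicity
statements. Convexity is closure of the cone under sums and scaling, and unitary invariance is
monotonicity in both directions.

The roof values of `ρ` are a slice of the convex hull of a compact set, so the minimum is attained.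
If it is zero, every vector of positive weight in an optimal decomposition has value zero; for `ω <
1` the eigenvalues of its reduced state satisfy `x ^ ω = x`, so it is a product vector. -/

noncomputable section

/-! ### Trace functions of Hermitian matrices -/

namespace Matrix

variable {n : Type*} [Fintype n] [DecidableEq n]

lemma IsHermitian.trace_cfc {A : Matrix n n ℂ} (hA : A.IsHermitian) (f : ℝ → ℝ) :
    (cfc f A).trace = ∑ i, (f (hA.eigenvalues i) : ℂ) := by
  rw [hA.cfc_eq, IsHermitian.cfc, Unitary.conjStarAlgAut_apply, trace_mul_cycle,
    Unitary.coe_star_mul_self, one_mul, trace_diagonal]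
  simp

lemma IsHermitian.re_trace_cfc {A : Matrix n n ℂ} (hA : A.IsHermitian) (f : ℝ → ℝ) :
    (cfc f A).trace.re = ∑ i, f (hA.eigenvalues i) := by
  rw [hA.trace_cfc, ← Complex.ofReal_sum, Complex.ofReal_re]

lemma sum_normSq_row_of_mem_unitaryGroup {W : Matrix n n ℂ} (hW : W ∈ unitaryGroup n ℂ) (i : n) :
    ∑ k, Complex.normSq (W i k) = 1 := by
  have h := congrFun (congrFun (mem_unitaryGroup_iff.1 hW) i) i
  rw [mul_apply, one_apply_eq] at h
  have h' : ∀ k, W i k * (star W) k i = (Complex.normSq (W i k) : ℂ) := fun k => by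
    rw [star_apply, RCLike.star_def, Complex.mul_conj]
  simp only [h', ← Complex.ofReal_sum] at h
  exact_mod_cast h

lemma sum_normSq_col_of_mem_unitaryGroup {W : Matrix n n ℂ} (hW : W ∈ unitaryGroup n ℂ) (k : n) :
    ∑ i, Complex.normSq (W i k) = 1 := by
  have h := congrFun (congrFun (mem_unitaryGroup_iff'.1 hW) k) k
  rw [mul_apply, one_apply_eq] at h
  have h' : ∀ i, (star W) k i * W i k = (Complex.normSq (W i k) : ℂ) := fun i => by
    rw [star_apply, RCLike.star_def, mul_comm, Complex.mul_conj]
  simp only [h', ← Complex.ofReal_sum] at h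
  exact_mod_cast h

/-- Peierls' inequality: a concave trace function is at most the sum of the function over the
diagonal entries in any orthonormal basis. -/
lemma PosSemidef.re_trace_cfc_le_sum_diag {A : Matrix n n ℂ} (hA : A.PosSemidef) {f : ℝ → ℝ}
    (hf : ConcaveOn ℝ (Set.Ici 0) f) {U : Matrix n n ℂ} (hU : U ∈ unitaryGroup n ℂ) :
    (cfc f A).trace.re ≤ ∑ i, f ((star U * A * U) i i).re := by
  rw [hA.1.re_trace_cfc]
  set V := hA.1.eigenvectorUnitary
  set W : Matrix n n ℂ := star U * (V : Matrix n n ℂ) with hWdef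
  have hW : W ∈ unitaryGroup n ℂ := mul_mem (Unitary.star_mem hU) V.2
  have hdiag : ∀ i, ((star U * A * U) i i).re
      = ∑ k, Complex.normSq (W i k) • hA.1.eigenvalues k := fun i => by
    have h1 : star U * A * U = W * diagonal (fun k => (hA.1.eigenvalues k : ℂ)) * star W := by
      conv_lhs => rw [hA.1.spectral_theorem, Unitary.conjStarAlgAut_apply]
      rw [hWdef, star_mul, star_star]
      simp only [Matrix.mul_assoc]
      rfl
    rw [h1, mul_apply, Complex.re_sum]
    refine Finset.sum_congr rfl fun k _ => ?_
    have h2 : star (W i k) = (starRingEnd ℂ) (W i k) := rfl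
    rw [mul_diagonal, star_apply, mul_right_comm, h2, Complex.mul_conj,
      ← Complex.ofReal_mul, Complex.ofReal_re, smul_eq_mul]
  -- The numbers `|W i k|²` form a doubly stochastic matrix: column sums insert the weights, row
  -- sums permit Jensen.
  calc ∑ k, f (hA.1.eigenvalues k)
      = ∑ k, (∑ i, Complex.normSq (W i k)) * f (hA.1.eigenvalues k) := by
        simp [sum_normSq_col_of_mem_unitaryGroup hW]
    _ = ∑ i, ∑ k, Complex.normSq (W i k) • f (hA.1.eigenvalues k) := by
        simp only [Finset.sum_mul, smul_eq_mul]
        exact Finset.sum_comm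
    _ ≤ ∑ i, f ((star U * A * U) i i).re := by
        refine Finset.sum_le_sum fun i _ => ?_
        rw [hdiag]
        exact hf.le_map_sum (fun _ _ => Complex.normSq_nonneg _)
          (sum_normSq_row_of_mem_unitaryGroup hW i) fun k _ => hA.eigenvalues_nonneg k

/-- Trace functions of concave functions are concave. -/
lemma concaveOn_re_trace_cfc {f : ℝ → ℝ} (hf : ConcaveOn ℝ (Set.Ici 0) f) :
    ConcaveOn ℝ {A : Matrix n n ℂ | A.PosSemidef} fun A => (cfc f A).trace.re := by
  have hconv : ∀ {A B : Matrix n n ℂ}, A.PosSemidef → B.PosSemidef → ∀ {a b : ℝ}, 0 ≤ a → 0 ≤ b →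
      (a • A + b • B).PosSemidef := fun hA hB a b ha hb => (hA.smul ha).add (hB.smul hb)
  refine ⟨fun A hA B hB a b ha hb _ => hconv hA hB ha hb, fun A hA B hB a b ha hb hab => ?_⟩
  have hC := hconv hA hB ha hb
  set C := a • A + b • B with hCdef
  -- In an eigenbasis of `C`, Peierls' inequality is an equality for `C` and still an upper bound
  -- for `A` and `B`; scalar concavity then compares diagonal entries.
  set U : Matrix n n ℂ := (hC.1.eigenvectorUnitary : Matrix n n ℂ)
  have hU : U ∈ unitaryGroup n ℂ := hC.1.eigenvectorUnitary.2
  have hdiag : ∀ i, hC.1.eigenvalues i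
      = a • ((star U * A * U) i i).re + b • ((star U * B * U) i i).re := fun i => by
    have h1 : star U * C * U = diagonal (fun k => (hC.1.eigenvalues k : ℂ)) := by
      have := hC.1.conjStarAlgAut_star_eigenvectorUnitary
      rw [Unitary.conjStarAlgAut_star_apply] at this
      exact this
    have h2 : star U * C * U = a • (star U * A * U) + b • (star U * B * U) := by
      rw [hCdef]; simp [Matrix.mul_add, Matrix.add_mul]
    have h3 := congrArg Complex.re (congrFun (congrFun (h1.symm.trans h2) i) i)
    simpa using h3
  have hnn : ∀ {M : Matrix n n ℂ}, M.PosSemidef → ∀ i, 0 ≤ ((star U * M * U) i i).re :=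
    fun hM i => (Complex.le_def.1 (hM.conjTranspose_mul_mul_same U).diag_nonneg).1
  have hA' := hA.re_trace_cfc_le_sum_diag hf hU
  have hB' := hB.re_trace_cfc_le_sum_diag hf hU
  simp only
  rw [hC.1.re_trace_cfc]
  calc a • (cfc f A).trace.re + b • (cfc f B).trace.re
      ≤ a • ∑ i, f ((star U * A * U) i i).re + b • ∑ i, f ((star U * B * U) i i).re := by
        simp only [smul_eq_mul]; gcongr
    _ = ∑ i, (a • f ((star U * A * U) i i).re + b • f ((star U * B * U) i i).re) := by
        rw [Finset.smul_sum, Finset.smul_sum, Finset.sum_add_distrib]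
    _ ≤ _ := Finset.sum_le_sum fun i _ => by
        rw [hdiag]; exact hf.2 (hnn hA i) (hnn hB i) ha hb hab

lemma IsHermitian.re_trace_cfc_eq_sum_roots {A : Matrix n n ℂ} (hA : A.IsHermitian)
    (f : ℝ → ℝ) : (cfc f A).trace.re = (A.charpoly.roots.map fun z : ℂ => f z.re).sum := by
  rw [hA.roots_charpoly_eq_eigenvalues, hA.re_trace_cfc]
  simp

/-- `tr f(A Aᴴ) = tr f(Aᴴ A)` if `f 0 = 0`. -/
lemma re_trace_cfc_mul_conjTranspose {m : Type*} [Fintype m] [DecidableEq m] {f : ℝ → ℝ}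
    (hf : f 0 = 0) (A : Matrix m n ℂ) :
    (cfc f (A * Aᴴ)).trace.re = (cfc f (Aᴴ * A)).trace.re := by
  have h := congrArg (fun p => (p.roots.map fun z : ℂ => f z.re).sum) (charpoly_mul_comm' A Aᴴ)
  -- The two characteristic polynomials agree up to powers of `X`, whose zero roots contribute `f 0
  -- = 0`.
  have hX : ∀ c : ℕ, ((c • ({0} : Multiset ℂ)).map fun z : ℂ => f z.re).sum = 0 := fun c => by
    simp [Multiset.map_nsmul, Multiset.sum_nsmul, hf]
  rwa [Polynomial.roots_mul (mul_ne_zero (pow_ne_zero _ Polynomial.X_ne_zero)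
      (charpoly_monic _).ne_zero), Polynomial.roots_mul (mul_ne_zero
      (pow_ne_zero _ Polynomial.X_ne_zero) (charpoly_monic _).ne_zero), Polynomial.roots_X_pow,
    Polynomial.roots_X_pow, Multiset.map_add, Multiset.map_add, Multiset.sum_add, Multiset.sum_add,
    hX, hX, zero_add, zero_add,
    ← (isHermitian_mul_conjTranspose_self A).re_trace_cfc_eq_sum_roots,
    ← (isHermitian_conjTranspose_mul_self A).re_trace_cfc_eq_sum_roots] at h

section Continuity
open scoped Matrix.Norms.L2Operator

/-- Continuity of the functional calculus in the matrix needs all spectra in one compact set;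
compactness of `s` bounds the norms, hence the spectra. -/
lemma continuousOn_re_trace_cfc {f : ℝ → ℝ} (hf : Continuous f) {X : Type*} [TopologicalSpace X]
    {s : Set X} (hs : IsCompact s) {a : X → Matrix n n ℂ} (ha : ContinuousOn a s)
    (hherm : ∀ x ∈ s, (a x).IsHermitian) :
    ContinuousOn (fun x => (cfc f (a x)).trace.re) s := by
  obtain ⟨R, hR⟩ := (hs.image_of_continuousOn ha).isBounded.exists_norm_le
  have : ContinuousOn (fun x => cfc f (a x)) s := by
    refine ContinuousOn.cfc' (isCompact_closedBall (0 : ℝ) (R * ‖(1 : Matrix n n ℂ)‖)) f ha (fun x hx => ?_)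
      (fun x hx => (hherm x hx).isSelfAdjoint) hf.continuousOn
    intro z hz
    exact mem_closedBall_zero_iff.2 ((spectrum.norm_le_norm_mul_of_mem hz).trans
      (mul_le_mul_of_nonneg_right (hR _ ⟨x, hx, rfl⟩) (norm_nonneg _)))
  exact Complex.continuous_re.comp_continuousOn
    ((continuous_id.matrix_trace).comp_continuousOn this)
end Continuity

end Matrix
end

/-! ### The homogeneous functional on positive semidefinite operators -/

noncomputable section

namespace GConcurrence

open Matrix

section Functional

variable {n : Type*} [Fintype n]

lemma re_trace_nonneg {A : Matrix n n ℂ} (hA : A.PosSemidef) : 0 ≤ A.trace.re :=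
  (Complex.le_def.1 hA.trace_nonneg).1

lemma trace_eq_re {A : Matrix n n ℂ} (hA : A.PosSemidef) : A.trace = (A.trace.re : ℂ) :=
  Complex.ext rfl (Complex.le_def.1 hA.trace_nonneg).2.symm

lemma eq_zero_of_re_trace_eq_zero {A : Matrix n n ℂ} (hA : A.PosSemidef) (h : A.trace.re = 0) :
    A = 0 :=
  hA.trace_eq_zero_iff.1 (by rw [trace_eq_re hA, h, Complex.ofReal_zero])

lemma isDensity_inv_smul {A : Matrix n n ℂ} (hA : A.PosSemidef) (h : A.trace.re ≠ 0) :
    IsDensity (A.trace.re⁻¹ • A) := by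
  refine ⟨hA.smul (inv_nonneg.2 (re_trace_nonneg hA)), ?_⟩
  rw [trace_smul]
  conv_lhs => rw [trace_eq_re hA]
  rw [Complex.real_smul, ← Complex.ofReal_mul, Complex.ofReal_re, inv_mul_cancel₀ h,
    Complex.ofReal_one]

variable [DecidableEq n]

/-- The positively homogeneous extension of `ρ ↦ (tr (ρ ^ ω) - 1) ^ ω` from density operators to
positive semidefinite operators. -/
def stateG (ω : ℝ) (A : Matrix n n ℂ) : ℝ :=
  A.trace.re * ((cfc (fun x : ℝ => x ^ ω) (A.trace.re⁻¹ • A)).trace.re - 1) ^ ω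

lemma stateG_zero (ω : ℝ) : stateG ω (0 : Matrix n n ℂ) = 0 := by simp [stateG]

lemma IsDensity.sum_eigenvalues {A : Matrix n n ℂ} (hA : IsDensity A) :
    ∑ i, hA.1.1.eigenvalues i = 1 := by
  have h := hA.1.1.trace_eq_sum_eigenvalues
  simpa using congrArg Complex.re (h.symm.trans hA.2)

lemma IsDensity.eigenvalues_le_one {A : Matrix n n ℂ} (hA : IsDensity A) (i : n) :
    hA.1.1.eigenvalues i ≤ 1 :=
  hA.sum_eigenvalues ▸ Finset.single_le_sum (fun j _ => hA.1.eigenvalues_nonneg j)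
    (Finset.mem_univ i)

variable {ω : ℝ}

lemma le_rpow_of_le_one (hω1 : ω ≤ 1) {x : ℝ} (h0 : 0 ≤ x) (h1 : x ≤ 1) :
    x ≤ x ^ ω := by
  rcases h0.eq_or_lt with rfl | h
  · exact Real.rpow_nonneg le_rfl _
  · simpa using Real.rpow_le_rpow_of_exponent_ge h h1 hω1

/-- Eigenvalues lie in `[0, 1]`, where `x ≤ x ^ ω`. This keeps the base of the outer power in the
range where that power is monotone and concave. -/
lemma one_le_re_trace_rpow (hω1 : ω ≤ 1) {A : Matrix n n ℂ} (hA : IsDensity A) :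
    1 ≤ (cfc (fun x : ℝ => x ^ ω) A).trace.re := by
  rw [hA.1.1.re_trace_cfc, ← hA.sum_eigenvalues]
  exact Finset.sum_le_sum fun i _ =>
    le_rpow_of_le_one hω1 (hA.1.eigenvalues_nonneg i) (hA.eigenvalues_le_one i)

lemma stateG_nonneg (hω1 : ω ≤ 1) {A : Matrix n n ℂ} (hA : A.PosSemidef) :
    0 ≤ stateG ω A := by
  by_cases h : A.trace.re = 0
  · simp [stateG, h]
  · exact mul_nonneg (re_trace_nonneg hA) (Real.rpow_nonneg
      (sub_nonneg.2 (one_le_re_trace_rpow hω1 (isDensity_inv_smul hA h))) _)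

lemma stateG_smul {c : ℝ} (A : Matrix n n ℂ) : stateG ω (c • A) = c * stateG ω A := by
  by_cases hc : c = 0
  · simp [stateG, hc]
  · have h : (c • A).trace.re = c * A.trace.re := by simp
    rw [stateG, stateG, h, smul_smul, mul_inv, mul_comm c⁻¹, mul_assoc A.trace.re⁻¹,
      inv_mul_cancel₀ hc, mul_one, mul_assoc]

/-- `stateG ω` is superadditive. -/
lemma stateG_add_le (hω0 : 0 < ω) (hω1 : ω ≤ 1) {A B : Matrix n n ℂ} (hA : A.PosSemidef)
    (hB : B.PosSemidef) : stateG ω A + stateG ω B ≤ stateG ω (A + B) := by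
  by_cases ha : A.trace.re = 0
  · rw [eq_zero_of_re_trace_eq_zero hA ha, stateG_zero, zero_add, zero_add]
  by_cases hb : B.trace.re = 0
  · rw [eq_zero_of_re_trace_eq_zero hB hb, stateG_zero, add_zero, add_zero]
  have dA := isDensity_inv_smul hA ha
  have dB := isDensity_inv_smul hB hb
  have hx := one_le_re_trace_rpow hω1 dA
  have hy := one_le_re_trace_rpow hω1 dB
  have hcab : (A + B).trace.re = A.trace.re + B.trace.re := by rw [trace_add, Complex.add_re]
  simp only [stateG, hcab]
  have ha' := lt_of_le_of_ne (re_trace_nonneg hA) (Ne.symm ha)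
  have hb' := lt_of_le_of_ne (re_trace_nonneg hB) (Ne.symm hb)
  set a := A.trace.re
  set b := B.trace.re
  have hab : 0 < a + b := add_pos ha' hb'
  have hsum : a / (a + b) + b / (a + b) = 1 := by field_simp
  have hf := Real.concaveOn_rpow hω0.le hω1
  have hconc := (concaveOn_re_trace_cfc (n := n) hf).2 dA.1 dB.1
    (div_nonneg ha'.le hab.le) (div_nonneg hb'.le hab.le) hsum
  -- The normalized sum is the mixture of the normalized summands with weights proportional to their
  -- traces.
  have hmix : (a / (a + b)) • (a⁻¹ • A) + (b / (a + b)) • (b⁻¹ • B) = (a + b)⁻¹ • (A + B) := by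
    rw [smul_smul, smul_smul, smul_add]
    congr 2 <;> field_simp
  simp only [hmix, smul_eq_mul] at hconc
  have h2 := hf.2 (sub_nonneg.2 hx) (sub_nonneg.2 hy)
    (div_nonneg ha'.le hab.le) (div_nonneg hb'.le hab.le) hsum
  simp only [smul_eq_mul] at h2
  set x := (cfc (fun x : ℝ => x ^ ω) (a⁻¹ • A)).trace.re
  set y := (cfc (fun x : ℝ => x ^ ω) (b⁻¹ • B)).trace.re
  set z := (cfc (fun x : ℝ => x ^ ω) ((a + b)⁻¹ • (A + B))).trace.re
  calc a * (x - 1) ^ ω + b * (y - 1) ^ ω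
      = (a + b) * (a / (a + b) * (x - 1) ^ ω + b / (a + b) * (y - 1) ^ ω) := by field_simp
    _ ≤ (a + b) * (a / (a + b) * (x - 1) + b / (a + b) * (y - 1)) ^ ω :=
        mul_le_mul_of_nonneg_left h2 hab.le
    _ ≤ (a + b) * (z - 1) ^ ω := by
        refine mul_le_mul_of_nonneg_left (Real.rpow_le_rpow ?_ ?_ hω0.le) hab.le
        · have := sub_nonneg.2 hx
          have := sub_nonneg.2 hy
          positivity
        · linear_combination hconc - hsum

lemma sum_stateG_le (hω0 : 0 < ω) (hω1 : ω ≤ 1) {ι : Type*} (s : Finset ι)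
    {A : ι → Matrix n n ℂ} (hA : ∀ i, (A i).PosSemidef) :
    ∑ i ∈ s, stateG ω (A i) ≤ stateG ω (∑ i ∈ s, A i) := by
  classical
  induction s using Finset.induction_on with
  | empty => simp [stateG_zero]
  | insert i s hi ih =>
    rw [Finset.sum_insert hi, Finset.sum_insert hi]
    exact (add_le_add_right ih _).trans
      (stateG_add_le hω0 hω1 (hA i) (posSemidef_sum s fun j _ => hA j))

lemma stateG_mul_conjTranspose {m : Type*} [Fintype m] [DecidableEq m] (hω0 : 0 < ω)
    (M : Matrix m n ℂ) : stateG ω (M * Mᴴ) = stateG ω (Mᴴ * M) := by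
  have ht : (M * Mᴴ).trace.re = (Mᴴ * M).trace.re := by rw [trace_mul_comm]
  have hnn : 0 ≤ (Mᴴ * M).trace.re⁻¹ :=
    inv_nonneg.2 (re_trace_nonneg (posSemidef_conjTranspose_mul_self M))
  rw [stateG, stateG, ht]
  set t := (Mᴴ * M).trace.re
  -- A square root of the normalization goes into each factor, so that the comparison of `N Nᴴ` with
  -- `Nᴴ N` applies.
  have h1 : t⁻¹ • (M * Mᴴ) = (√t⁻¹ • M) * (√t⁻¹ • M)ᴴ := by
    rw [conjTranspose_smul, Matrix.smul_mul, Matrix.mul_smul, smul_smul, star_trivial, Real.mul_self_sqrt hnn]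
  have h2 : t⁻¹ • (Mᴴ * M) = (√t⁻¹ • M)ᴴ * (√t⁻¹ • M) := by
    rw [conjTranspose_smul, Matrix.smul_mul, Matrix.mul_smul, smul_smul, star_trivial, Real.mul_self_sqrt hnn]
  rw [h1, h2, re_trace_cfc_mul_conjTranspose (f := fun x : ℝ => x ^ ω) (Real.zero_rpow hω0.ne')]

end Functional

/-! ### Bipartite vectors and local measurements on them -/

variable {m n m' n' : ℕ} {ω : ℝ}

/-- The coefficient matrix of a bipartite vector. -/
def coeffs (ψ : Vec m n) : Matrix (Fin m) (Fin n) ℂ := of fun i j => ψ (i, j)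

lemma traceB_proj (ψ : Vec m n) : traceB (proj ψ) = coeffs ψ * (coeffs ψ)ᴴ := by
  ext i j
  simp [traceB, proj, coeffs, mul_apply, vecMulVec_apply]

lemma trace_proj (ψ : Vec m n) : (proj ψ).trace = star ψ ⬝ᵥ ψ := by
  simp [proj, trace, vecMulVec_apply, dotProduct, mul_comm]

lemma trace_coeffs (ψ : Vec m n) : (coeffs ψ * (coeffs ψ)ᴴ).trace = star ψ ⬝ᵥ ψ := by
  simp [coeffs, trace, mul_apply, dotProduct, mul_comm, Fintype.sum_prod_type]

/-- The positively homogeneous extension of `pureG` to all vectors. -/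
def vecG (ω : ℝ) (ψ : Vec m n) : ℝ := stateG ω (coeffs ψ * (coeffs ψ)ᴴ)

lemma vecG_nonneg (hω1 : ω ≤ 1) (ψ : Vec m n) : 0 ≤ vecG ω ψ :=
  stateG_nonneg hω1 (posSemidef_self_mul_conjTranspose _)

lemma isDensity_coeffs {φ : Vec m n} (hφ : IsUnitVec φ) :
    IsDensity (coeffs φ * (coeffs φ)ᴴ) :=
  ⟨posSemidef_self_mul_conjTranspose _, (trace_coeffs φ).trans hφ⟩

lemma pureG_eq (φ : Vec m n) : pureG ω φ =
    ((cfc (fun x : ℝ => x ^ ω) (coeffs φ * (coeffs φ)ᴴ)).trace.re - 1) ^ ω := by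
  rw [pureG, matPow, traceB_proj]

lemma vecG_of_isUnitVec {φ : Vec m n} (hφ : IsUnitVec φ) : vecG ω φ = pureG ω φ := by
  rw [vecG, stateG, (isDensity_coeffs hφ).2, pureG_eq]
  simp

lemma pureG_nonneg (hω1 : ω ≤ 1) {φ : Vec m n} (hφ : IsUnitVec φ) :
    0 ≤ pureG ω φ := vecG_of_isUnitVec (ω := ω) hφ ▸ vecG_nonneg hω1 φ

lemma coeffs_smul (c : ℂ) (ψ : Vec m n) : coeffs (c • ψ) = c • coeffs ψ := rfl

lemma vecG_sqrt_smul {c : ℝ} (hc : 0 ≤ c) (ψ : Vec m n) :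
    vecG ω (((√c : ℝ) : ℂ) • ψ) = c * vecG ω ψ := by
  rw [vecG, vecG, ← stateG_smul, coeffs_smul]
  congr 1
  rw [conjTranspose_smul, Matrix.smul_mul, Matrix.mul_smul, smul_smul, RCLike.star_def, Complex.conj_ofReal,
    ← Complex.ofReal_mul, Real.mul_self_sqrt hc]
  rfl

lemma proj_sqrt_smul {c : ℝ} (hc : 0 ≤ c) (ψ : Vec m n) :
    proj (((√c : ℝ) : ℂ) • ψ) = (c : ℂ) • proj ψ := by
  rw [proj, star_smul, smul_vecMulVec, vecMulVec_smul, smul_smul, RCLike.star_def,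
    Complex.conj_ofReal, ← Complex.ofReal_mul, Real.mul_self_sqrt hc]
  rfl

lemma proj_mulVec (L : Matrix (Fin m' × Fin n') (Fin m × Fin n) ℂ) (ψ : Vec m n) :
    proj (L *ᵥ ψ) = L * proj ψ * Lᴴ := by
  rw [proj, proj, star_mulVec, mul_vecMulVec, vecMulVec_mul]

lemma coeffs_kronecker_one_mulVec {l : ℕ} (K : Matrix (Fin l) (Fin m) ℂ) (ψ : Vec m n) :
    coeffs ((K ⊗ₖ (1 : Matrix (Fin n) (Fin n) ℂ)) *ᵥ ψ) = K * coeffs ψ := by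
  ext i j
  simp [coeffs, mulVec, dotProduct, mul_apply, Fintype.sum_prod_type, one_apply]

lemma coeffs_one_kronecker_mulVec {l : ℕ} (K : Matrix (Fin l) (Fin n) ℂ) (ψ : Vec m n) :
    coeffs (((1 : Matrix (Fin m) (Fin m) ℂ) ⊗ₖ K) *ᵥ ψ) = coeffs ψ * Kᵀ := by
  ext i j
  simp [coeffs, mulVec, dotProduct, mul_apply, Fintype.sum_prod_type, one_apply, mul_comm]

/-- Alice's measurement preserves Bob's reduced state on average, so the value is computed from `Mᴴ
M`, the transpose of that state. -/
lemma sum_vecG_alice_le (hω0 : 0 < ω) (hω1 : ω ≤ 1) {l k : ℕ}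
    {K : Fin k → Matrix (Fin l) (Fin m) ℂ} (hK : ∑ i, (K i)ᴴ * K i = 1) (ψ : Vec m n) :
    ∑ i, vecG ω ((K i ⊗ₖ (1 : Matrix (Fin n) (Fin n) ℂ)) *ᵥ ψ) ≤ vecG ω ψ := by
  simp only [vecG, coeffs_kronecker_one_mulVec, stateG_mul_conjTranspose hω0]
  refine (sum_stateG_le hω0 hω1 _ fun i => posSemidef_conjTranspose_mul_self _).trans
    (le_of_eq (congrArg _ ?_))
  calc ∑ i, (K i * coeffs ψ)ᴴ * (K i * coeffs ψ)
      = (coeffs ψ)ᴴ * (∑ i, (K i)ᴴ * K i) * coeffs ψ := by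
        rw [Matrix.mul_sum, Matrix.sum_mul]
        simp only [conjTranspose_mul, Matrix.mul_assoc]
    _ = _ := by rw [hK, Matrix.mul_one]

/-- Bob's operators act on the right of `M` and preserve `M Mᴴ` on average, so no exchange of the
two sides is needed. -/
lemma sum_vecG_bob_le (hω0 : 0 < ω) (hω1 : ω ≤ 1) {l k : ℕ}
    {K : Fin k → Matrix (Fin l) (Fin n) ℂ} (hK : ∑ i, (K i)ᴴ * K i = 1) (ψ : Vec m n) :
    ∑ i, vecG ω (((1 : Matrix (Fin m) (Fin m) ℂ) ⊗ₖ K i) *ᵥ ψ) ≤ vecG ω ψ := by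
  simp only [vecG, coeffs_one_kronecker_mulVec]
  refine (sum_stateG_le hω0 hω1 _ fun i => posSemidef_self_mul_conjTranspose _).trans
    (le_of_eq (congrArg _ ?_))
  calc ∑ i, (coeffs ψ * (K i)ᵀ) * (coeffs ψ * (K i)ᵀ)ᴴ
      = coeffs ψ * (∑ i, (K i)ᴴ * K i)ᵀ * (coeffs ψ)ᴴ := by
        rw [transpose_sum, Matrix.mul_sum, Matrix.sum_mul]
        simp only [conjTranspose_mul, transpose_mul, Matrix.mul_assoc]
        rfl
    _ = _ := by rw [hK, transpose_one, Matrix.mul_one]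

end GConcurrence
end

/-! ### The cone of decompositions and LOCC protocols -/

noncomputable section

namespace GConcurrence

open Matrix

variable {m n m' n' : ℕ} {ω : ℝ}

/-- The pairs `(ρ, x)` such that `ρ` is a finite sum of operators `|ψ⟩⟨ψ|` with the values
`vecG ω ψ` adding up to at most `x`. -/
def roofCone (ω : ℝ) (m n : ℕ) : AddSubmonoid (Op m n × ℝ) :=
  AddSubmonoid.closure {z | ∃ ψ : Vec m n, z.1 = proj ψ ∧ vecG ω ψ ≤ z.2}

lemma proj_mem_roofCone {ψ : Vec m n} {x : ℝ} (h : vecG ω ψ ≤ x) :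
    (proj ψ, x) ∈ roofCone ω m n :=
  AddSubmonoid.subset_closure ⟨ψ, rfl, h⟩

/-- Induction on membership in `roofCone`. -/
lemma roofCone_induction {motive : Op m n → ℝ → Prop}
    (hproj : ∀ (ψ : Vec m n) (x : ℝ), vecG ω ψ ≤ x → motive (proj ψ) x) (hzero : motive 0 0)
    (hadd : ∀ ρ x σ y, motive ρ x → motive σ y → motive (ρ + σ) (x + y))
    {ρ : Op m n} {x : ℝ} (h : (ρ, x) ∈ roofCone ω m n) : motive ρ x := by
  have : ∀ z ∈ roofCone ω m n, motive z.1 z.2 := fun z hz => by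
    induction hz using AddSubmonoid.closure_induction with
    | mem z hz => obtain ⟨ψ, h1, h2⟩ := hz; rw [h1]; exact hproj ψ _ h2
    | zero => exact hzero
    | add z w _ _ hz hw => exact hadd _ _ _ _ hz hw
  exact this _ h

lemma vecG_zero : vecG ω (0 : Vec m n) = 0 := by
  have : coeffs (0 : Vec m n) = 0 := rfl
  rw [vecG, this, Matrix.zero_mul, stateG_zero]

lemma proj_zero : proj (0 : Vec m n) = 0 := by simp [proj]

lemma zero_mem_roofCone {x : ℝ} (hx : 0 ≤ x) : ((0 : Op m n), x) ∈ roofCone ω m n := by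
  rw [← proj_zero]
  exact proj_mem_roofCone (vecG_zero.trans_le hx)

lemma sum_mem_roofCone {κ : Type*} {s : Finset κ} {ρ : κ → Op m n} {x : κ → ℝ}
    (h : ∀ i ∈ s, (ρ i, x i) ∈ roofCone ω m n) :
    (∑ i ∈ s, ρ i, ∑ i ∈ s, x i) ∈ roofCone ω m n := by
  have heq : (∑ i ∈ s, ρ i, ∑ i ∈ s, x i) = ∑ i ∈ s, (ρ i, x i) :=
    Prod.ext (by simp [Prod.fst_sum]) (by simp [Prod.snd_sum])
  exact heq ▸ sum_mem h

lemma smul_mem_roofCone {c : ℝ} (hc : 0 ≤ c) {ρ : Op m n} {x : ℝ}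
    (h : (ρ, x) ∈ roofCone ω m n) : ((c : ℂ) • ρ, c * x) ∈ roofCone ω m n := by
  refine roofCone_induction (motive := fun ρ x => ((c : ℂ) • ρ, c * x) ∈ roofCone ω m n)
    (fun ψ x hx => ?_) ?_ (fun ρ x σ y hρ hσ => ?_) h
  · rw [← proj_sqrt_smul hc]
    exact proj_mem_roofCone ((vecG_sqrt_smul hc ψ).trans_le (mul_le_mul_of_nonneg_left hx hc))
  · simp only [smul_zero, mul_zero]
    exact zero_mem _
  · rw [smul_add, mul_add]
    exact add_mem hρ hσ

lemma posSemidef_of_mem_roofCone {ρ : Op m n} {x : ℝ} (h : (ρ, x) ∈ roofCone ω m n) :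
    ρ.PosSemidef :=
  roofCone_induction (motive := fun ρ _ => ρ.PosSemidef)
    (fun ψ _ _ => posSemidef_vecMulVec_self_star ψ) PosSemidef.zero
    (fun _ _ _ _ h1 h2 => h1.add h2) h

lemma nonneg_of_mem_roofCone (hω1 : ω ≤ 1) {ρ : Op m n} {x : ℝ}
    (h : (ρ, x) ∈ roofCone ω m n) : 0 ≤ x :=
  roofCone_induction (motive := fun _ x => 0 ≤ x)
    (fun ψ _ hx => (vecG_nonneg hω1 ψ).trans hx) le_rfl
    (fun _ _ _ _ h1 h2 => add_nonneg h1 h2) h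

lemma exists_sum_of_mem_roofCone {ρ : Op m n} {x : ℝ} (h : (ρ, x) ∈ roofCone ω m n) :
    ∃ (N : ℕ) (ψ : Fin N → Vec m n), ρ = ∑ i, proj (ψ i) ∧ ∑ i, vecG ω (ψ i) ≤ x := by
  refine roofCone_induction (motive := fun ρ x => ∃ (N : ℕ) (ψ : Fin N → Vec m n),
    ρ = ∑ i, proj (ψ i) ∧ ∑ i, vecG ω (ψ i) ≤ x) (fun ψ x hx => ?_) ?_ ?_ h
  · exact ⟨1, fun _ => ψ, by simp, by simpa using hx⟩
  · exact ⟨0, Fin.elim0, by simp, by simp⟩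
  · rintro ρ x σ y ⟨N, ψ, rfl, hx⟩ ⟨M, χ, rfl, hy⟩
    refine ⟨N + M, Fin.append ψ χ, by simp [Fin.sum_univ_add], ?_⟩
    simpa [Fin.sum_univ_add] using add_le_add hx hy

/-! ### Comparison with the convex roof -/

lemma exists_normalization [Nonempty (Fin m × Fin n)] (ψ : Vec m n) :
    ∃ (p : ℝ) (φ : Vec m n), 0 ≤ p ∧ IsUnitVec φ ∧ ψ = ((√p : ℝ) : ℂ) • φ := by
  obtain ⟨p, hp⟩ : ∃ p : ℝ, star ψ ⬝ᵥ ψ = (p : ℂ) :=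
    ⟨_, Complex.ext rfl (Complex.le_def.1 (dotProduct_star_self_nonneg ψ)).2.symm⟩
  have hp0 : 0 ≤ p := by
    have := dotProduct_star_self_nonneg ψ
    rw [hp] at this
    exact_mod_cast this
  rcases hp0.eq_or_lt with rfl | hpos
  · obtain ⟨e⟩ := ‹Nonempty (Fin m × Fin n)›
    -- The zero vector gets weight zero and an arbitrary unit vector, which exists because the space
    -- is nonzero.
    refine ⟨0, Pi.single e 1, le_rfl, ?_, ?_⟩
    · simp [IsUnitVec]
    · rw [Complex.ofReal_zero, dotProduct_star_self_eq_zero] at hp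
      simp [hp]
  · have hs : ((√p : ℝ) : ℂ) ≠ 0 := by exact_mod_cast (Real.sqrt_pos.2 hpos).ne'
    refine ⟨p, ((√p : ℝ) : ℂ)⁻¹ • ψ, hp0, ?_, ?_⟩
    · rw [IsUnitVec, star_smul, smul_dotProduct, dotProduct_smul, hp, smul_smul, RCLike.star_def,
        map_inv₀, Complex.conj_ofReal, smul_eq_mul, ← mul_inv, ← Complex.ofReal_mul,
        Real.mul_self_sqrt hp0, inv_mul_cancel₀]
      exact_mod_cast hpos.ne'
    · rw [smul_smul, mul_inv_cancel₀ hs, one_smul]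

lemma nonempty_of_trace_eq_one {α : Type*} [Fintype α] {ρ : Matrix α α ℂ} (h : ρ.trace = 1) :
    Nonempty α := by
  by_contra hα
  rw [not_nonempty_iff] at hα
  simp [trace] at h

lemma exists_roofValue_le {ρ : Op m n} {x : ℝ} (h : (ρ, x) ∈ roofCone ω m n)
    (hρ : ρ.trace = 1) : ∃ y ∈ roofValues ω ρ, y ≤ x := by
  have := nonempty_of_trace_eq_one hρ
  obtain ⟨N, ψ, rfl, hx⟩ := exists_sum_of_mem_roofCone h
  choose p φ hp hφ hψ using fun i => exists_normalization (ψ i)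
  have hproj : ∀ i, proj (ψ i) = (p i : ℂ) • proj (φ i) := fun i => by
    rw [hψ i, proj_sqrt_smul (hp i)]
  have hvec : ∀ i, vecG ω (ψ i) = p i * pureG ω (φ i) := fun i => by
    rw [hψ i, vecG_sqrt_smul (hp i), vecG_of_isUnitVec (hφ i)]
  refine ⟨∑ i, p i * pureG ω (φ i), ⟨N, p, φ, ⟨hp, ?_, hφ, by simp only [hproj]⟩, rfl⟩, ?_⟩
  · have h1 : ∀ i, (proj (φ i)).trace = 1 := fun i => (trace_proj _).trans (hφ i)
    simp only [hproj, trace_sum, trace_smul, h1, smul_eq_mul, mul_one] at hρ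
    exact_mod_cast hρ
  · simpa only [hvec] using hx

lemma mem_roofCone_of_roofValue {ρ : Op m n} {x : ℝ} (h : x ∈ roofValues ω ρ) :
    (ρ, x) ∈ roofCone ω m n := by
  obtain ⟨N, p, φ, hd, rfl⟩ := h
  rw [hd.eq_sum]
  exact sum_mem_roofCone fun i _ => smul_mem_roofCone (hd.nonneg i)
    (proj_mem_roofCone (vecG_of_isUnitVec (hd.unit i)).le)

lemma roofValues_nonneg (hω1 : ω ≤ 1) {ρ : Op m n} {x : ℝ} (h : x ∈ roofValues ω ρ) : 0 ≤ x :=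
  nonneg_of_mem_roofCone hω1 (mem_roofCone_of_roofValue h)

lemma gConc_le_of_mem_roofCone (hω1 : ω ≤ 1) {ρ : Op m n} {x : ℝ}
    (h : (ρ, x) ∈ roofCone ω m n) (hρ : ρ.trace = 1) : gConc ω ρ ≤ x := by
  obtain ⟨y, hy, hyx⟩ := exists_roofValue_le h hρ
  exact (csInf_le ⟨0, fun _ => roofValues_nonneg hω1⟩ hy).trans hyx

/-- Positivity of `ρ` plays no role: without decompositions, the infimum of the empty set is zero.
-/
lemma gConc_nonneg (hω1 : ω ≤ 1) (ρ : Op m n) : 0 ≤ gConc ω ρ :=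
  Real.sInf_nonneg fun _ => roofValues_nonneg hω1

lemma exists_mem_roofCone {ρ : Op m n} (hρ : ρ.PosSemidef) : ∃ x, (ρ, x) ∈ roofCone ω m n := by
  obtain ⟨N, ψ, rfl⟩ := posSemidef_iff_eq_sum_vecMulVec.1 hρ
  exact ⟨_, sum_mem_roofCone fun i _ => proj_mem_roofCone (le_refl (vecG ω (ψ i)))⟩

lemma roofValues_nonempty {ρ : Op m n} (hρ : IsDensity ρ) : (roofValues ω ρ).Nonempty := by
  obtain ⟨x, hx⟩ := exists_mem_roofCone (ω := ω) hρ.1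
  obtain ⟨y, hy, -⟩ := exists_roofValue_le hx hρ.2
  exact ⟨y, hy⟩

/-! ### Local operations -/

/-- A bound on vectors suffices, because both the cone and the maps `ρ ↦ L i * ρ * (L i)ᴴ` are
additive. -/
lemma exists_sum_mem_roofCone_of_kraus {k : ℕ}
    {L : Fin k → Matrix (Fin m' × Fin n') (Fin m × Fin n) ℂ}
    (hL : ∀ ψ : Vec m n, ∑ i, vecG ω (L i *ᵥ ψ) ≤ vecG ω ψ) {ρ : Op m n} {x : ℝ}
    (h : (ρ, x) ∈ roofCone ω m n) :
    ∃ y : Fin k → ℝ, (∀ i, (L i * ρ * (L i)ᴴ, y i) ∈ roofCone ω m' n') ∧ ∑ i, y i ≤ x := by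
  refine roofCone_induction (motive := fun ρ x => ∃ y : Fin k → ℝ,
    (∀ i, (L i * ρ * (L i)ᴴ, y i) ∈ roofCone ω m' n') ∧ ∑ i, y i ≤ x) (fun ψ x hx => ?_) ?_ ?_ h
  · refine ⟨fun i => vecG ω (L i *ᵥ ψ), fun i => ?_, (hL ψ).trans hx⟩
    rw [← proj_mulVec]
    exact proj_mem_roofCone le_rfl
  · exact ⟨0, fun i => by simpa using zero_mem_roofCone le_rfl, by simp⟩
  · rintro ρ x σ y ⟨a, ha, hax⟩ ⟨b, hb, hby⟩
    refine ⟨a + b, fun i => ?_, ?_⟩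
    · rw [Matrix.mul_add, Matrix.add_mul]
      exact add_mem (ha i) (hb i)
    · simpa [Finset.sum_add_distrib] using add_le_add hax hby

namespace LOCC

variable {ι : Type*} [DecidableEq ι] [Fintype ι]

lemma exists_branch_mem_roofCone (hω0 : 0 < ω) (hω1 : ω ≤ 1) (P : LOCC ι m' n' m n)
    {ρ : Op m n} {x : ℝ} (h : (ρ, x) ∈ roofCone ω m n) :
    ∃ y : ι → ℝ, (∀ j, (P.branch ρ j, y j) ∈ roofCone ω m' n') ∧ ∑ j, y j ≤ x := by
  induction P generalizing x with
  | finish o =>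
    refine ⟨fun j => if o = j then x else 0, fun j => ?_, by simp⟩
    by_cases hj : o = j
    · simpa [branch, hj] using h
    · simpa [branch, hj] using zero_mem_roofCone le_rfl
  | alice K hK next ih =>
    obtain ⟨y, hy, hyx⟩ := exists_sum_mem_roofCone_of_kraus (sum_vecG_alice_le hω0 hω1 hK) h
    choose z hz hzy using fun i => ih i (hy i)
    refine ⟨fun j => ∑ i, z i j, fun j => ?_, ?_⟩
    -- Forgetting part of the record is addition in the cone.
    · exact sum_mem_roofCone fun i _ => hz i j
    · rw [Finset.sum_comm]
      exact (Finset.sum_le_sum fun i _ => hzy i).trans hyx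
  | bob K hK next ih =>
    obtain ⟨y, hy, hyx⟩ := exists_sum_mem_roofCone_of_kraus (sum_vecG_bob_le hω0 hω1 hK) h
    choose z hz hzy using fun i => ih i (hy i)
    refine ⟨fun j => ∑ i, z i j, fun j => ?_, ?_⟩
    · exact sum_mem_roofCone fun i _ => hz i j
    · rw [Finset.sum_comm]
      exact (Finset.sum_le_sum fun i _ => hzy i).trans hyx

lemma sum_trace_kraus {α β : Type*} [Fintype α] [Fintype β] [DecidableEq α] {k : ℕ}
    {L : Fin k → Matrix β α ℂ} (hL : ∑ i, (L i)ᴴ * L i = 1) (ρ : Matrix α α ℂ) :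
    ∑ i, (L i * ρ * (L i)ᴴ).trace = ρ.trace := by
  calc ∑ i, (L i * ρ * (L i)ᴴ).trace = ((∑ i, (L i)ᴴ * L i) * ρ).trace := by
        rw [Matrix.sum_mul, trace_sum]
        exact Finset.sum_congr rfl fun i _ => trace_mul_cycle _ _ _
    _ = ρ.trace := by rw [hL, Matrix.one_mul]

lemma sum_trace_branch (P : LOCC ι m' n' m n) (ρ : Op m n) :
    ∑ j, (P.branch ρ j).trace = ρ.trace := by
  induction P with
  | finish o => simp [branch, apply_ite trace]
  | alice K hK next ih =>
    simp only [branch, trace_sum]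
    rw [Finset.sum_comm]
    simp only [ih]
    refine sum_trace_kraus ?_ ρ
    simp only [conjTranspose_kronecker, ← mul_kronecker_mul, conjTranspose_one, Matrix.one_mul]
    rw [← one_kronecker_one, ← hK]
    ext ⟨a, b⟩ ⟨c, d⟩
    simp [Matrix.sum_apply, kroneckerMap_apply, Finset.sum_mul]
  | bob K hK next ih =>
    simp only [branch, trace_sum]
    rw [Finset.sum_comm]
    simp only [ih]
    refine sum_trace_kraus ?_ ρ
    simp only [conjTranspose_kronecker, ← mul_kronecker_mul, conjTranspose_one, Matrix.one_mul]
    rw [← one_kronecker_one, ← hK]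
    ext ⟨a, b⟩ ⟨c, d⟩
    simp [Matrix.sum_apply, kroneckerMap_apply, Finset.mul_sum]

lemma gConc_channel_le_of_mem_roofCone (hω0 : 0 < ω) (hω1 : ω ≤ 1) (P : LOCC ι m' n' m n)
    {ρ : Op m n} (hρ : ρ.trace = 1) {x : ℝ} (h : (ρ, x) ∈ roofCone ω m n) :
    gConc ω (P.channel ρ) ≤ x := by
  obtain ⟨y, hy, hyx⟩ := P.exists_branch_mem_roofCone hω0 hω1 h
  refine (gConc_le_of_mem_roofCone hω1 (sum_mem_roofCone fun j _ => hy j) ?_).trans hyx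
  rw [trace_sum, sum_trace_branch, hρ]

lemma sum_prob_mul_gConc_post_le_of_mem_roofCone (hω0 : 0 < ω) (hω1 : ω ≤ 1)
    (P : LOCC ι m' n' m n) {ρ : Op m n} {x : ℝ} (h : (ρ, x) ∈ roofCone ω m n) :
    ∑ j, P.prob ρ j * gConc ω (P.post ρ j) ≤ x := by
  obtain ⟨y, hy, hyx⟩ := P.exists_branch_mem_roofCone hω0 hω1 h
  refine (Finset.sum_le_sum fun j _ => ?_).trans hyx
  have hpsd := posSemidef_of_mem_roofCone (hy j)
  -- An outcome of probability zero contributes zero whatever `post` is there, so the sum over all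
  -- `j` is the sum over `p_j > 0`.
  by_cases hp : P.prob ρ j = 0
  · rw [hp, zero_mul]
    exact nonneg_of_mem_roofCone hω1 (hy j)
  · have hp0 : 0 ≤ P.prob ρ j := re_trace_nonneg hpsd
    have hmem := smul_mem_roofCone (inv_nonneg.2 hp0) (hy j)
    rw [Complex.ofReal_inv] at hmem
    have htr : (P.post ρ j).trace = 1 := by
      rw [post, trace_smul, trace_eq_re hpsd, smul_eq_mul]
      exact inv_mul_cancel₀ (Complex.ofReal_ne_zero.2 hp)
    calc P.prob ρ j * gConc ω (P.post ρ j)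
        ≤ P.prob ρ j * ((P.prob ρ j)⁻¹ * y j) :=
          mul_le_mul_of_nonneg_left (gConc_le_of_mem_roofCone hω1 hmem htr) hp0
      _ = y j := by rw [← mul_assoc, mul_inv_cancel₀ hp, one_mul]

end LOCC

end GConcurrence
end

/-! ### Attainment of the minimum, and its consequences -/

noncomputable section

/-- The convex hull of a compact set in a finite-dimensional space is compact. -/
theorem IsCompact.convexHull_of_finiteDimensional {E : Type*} [AddCommGroup E] [Module ℝ E]
    [TopologicalSpace E] [ContinuousAdd E] [ContinuousSMul ℝ E] [FiniteDimensional ℝ E] {s : Set E}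
    (hs : IsCompact s) : IsCompact (convexHull ℝ s) := by
  classical
  -- Carathéodory: this many points always suffice.
  set N := Module.finrank ℝ E + 1
  set F : (Fin N → ℝ) × (Fin N → E) → E := fun q => ∑ i, q.1 i • q.2 i
  have hF : Continuous F := by fun_prop
  have himage : convexHull ℝ s = F '' (stdSimplex ℝ (Fin N) ×ˢ Set.univ.pi fun _ => s) := by
    refine Set.Subset.antisymm (fun x hx => ?_) ?_
    · obtain ⟨ι, _, z, w, hz, hind, hw, hw1, rfl⟩ := eq_pos_convex_span_of_mem_convexHull hx
      have hcard : Fintype.card ι ≤ Fintype.card (Fin N) := by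
        rw [Fintype.card_fin]
        exact hind.card_le_finrank_succ.trans
          (Nat.add_le_add_right (Submodule.finrank_le _) 1)
      obtain ⟨e⟩ := Function.Embedding.nonempty_of_card_le hcard
      have hne : Nonempty ι := by
        by_contra h
        rw [not_nonempty_iff] at h
        simp at hw1
      obtain ⟨i₀⟩ := hne
      -- Unused slots are padded with weight zero and a fixed point of `s`.
      refine ⟨(Function.extend e w 0, Function.extend e z fun _ => z i₀), ⟨⟨fun j => ?_, ?_⟩, ?_⟩, ?_⟩
      · by_cases hj : ∃ i, e i = j
        · obtain ⟨i, rfl⟩ := hj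
          simpa [e.injective.extend_apply] using (hw i).le
        · simp [Function.extend_apply' _ _ _ hj]
      · rw [← hw1, ← Finset.sum_subset (Finset.subset_univ (Finset.univ.map e)) fun j _ hj => ?_]
        · simp [e.injective.extend_apply]
        · exact Function.extend_apply' _ _ _ fun ⟨i, hi⟩ => hj (by simp [← hi])
      · intro j _
        by_cases hj : ∃ i, e i = j
        · obtain ⟨i, rfl⟩ := hj
          simpa [e.injective.extend_apply] using hz ⟨i, rfl⟩
        · simpa [Function.extend_apply' _ _ _ hj] using hz ⟨i₀, rfl⟩
      · simp only [F]
        rw [← Finset.sum_subset (Finset.subset_univ (Finset.univ.map e)) fun j _ hj => ?_]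
        · simp [e.injective.extend_apply]
        · have hj' : ¬ ∃ i, e i = j := fun ⟨i, hi⟩ => hj (by simp [← hi])
          simp [Function.extend_apply' _ _ _ hj']
    · rintro _ ⟨⟨w, z⟩, ⟨hw, hz⟩, rfl⟩
      exact mem_convexHull_of_exists_fintype w z hw.1 hw.2 (fun i => hz i trivial) rfl
  rw [himage]
  exact ((isCompact_stdSimplex ℝ _).prod (isCompact_univ_pi fun _ => hs)).image hF

namespace GConcurrence

open Matrix

variable {m n : ℕ} {ω : ℝ}

lemma isCompact_setOf_isUnitVec : IsCompact {φ : Vec m n | IsUnitVec φ} := by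
  refine Metric.isCompact_of_isClosed_isBounded ?_ ?_
  · exact isClosed_eq (by fun_prop) continuous_const
  · refine (Metric.isBounded_closedBall (x := (0 : Vec m n)) (r := 1)).subset fun φ hφ => ?_
    rw [mem_closedBall_zero_iff, pi_norm_le_iff_of_nonneg zero_le_one]
    intro i
    have h1 : ∑ j, ‖φ j‖ ^ 2 = 1 := by
      have h : ∑ j, star (φ j) * φ j = 1 := hφ
      have h' : ∀ j, star (φ j) * φ j = ((‖φ j‖ ^ 2 : ℝ) : ℂ) := fun j => by
        rw [RCLike.star_def, Complex.conj_mul', Complex.ofReal_pow]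
      simp only [h', ← Complex.ofReal_sum] at h
      exact_mod_cast h
    have h2 : ‖φ i‖ ^ 2 ≤ 1 :=
      h1 ▸ Finset.single_le_sum (f := fun j => ‖φ j‖ ^ 2) (fun j _ => sq_nonneg _)
        (Finset.mem_univ i)
    exact (sq_le_one_iff₀ (norm_nonneg _)).1 h2

lemma continuousOn_pureG (hω0 : 0 < ω) :
    ContinuousOn (fun φ : Vec m n => pureG ω φ) {φ | IsUnitVec φ} := by
  simp only [pureG_eq]
  have hc : Continuous fun φ : Vec m n => coeffs φ := by
    unfold coeffs; fun_prop
  have hf : Continuous fun x : ℝ => x ^ ω := Real.continuous_rpow_const hω0.le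
  exact hf.comp_continuousOn ((continuousOn_re_trace_cfc hf isCompact_setOf_isUnitVec
    (hc.matrix_mul hc.matrix_conjTranspose).continuousOn
    fun φ _ => isHermitian_mul_conjTranspose_self _).sub continuousOn_const)

/-- Roof values become a fibre of the convex hull of the graph of `pureG` over pure states; this
removes the unbounded number of terms. -/
lemma mem_roofValues_iff {ρ : Op m n} {x : ℝ} : x ∈ roofValues ω ρ ↔
    (ρ, x) ∈ convexHull ℝ ((fun φ : Vec m n => (proj φ, pureG ω φ)) '' {φ | IsUnitVec φ}) := by
  constructor
  · rintro ⟨N, p, φ, hd, rfl⟩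
    refine mem_convexHull_of_exists_fintype p (fun i => (proj (φ i), pureG ω (φ i))) hd.nonneg
      hd.sum_eq_one (fun i => ⟨φ i, hd.unit i, rfl⟩) (Prod.ext ?_ ?_)
    · rw [Prod.fst_sum, hd.eq_sum]; rfl
    · rw [Prod.snd_sum]; rfl
  · intro h
    obtain ⟨ι, _, w, z, hw, hw1, hz, hx⟩ := mem_convexHull_iff_exists_fintype.1 h
    choose φ hφ hφz using hz
    set e := (Fintype.equivFin ι).symm
    refine ⟨Fintype.card ι, w ∘ e, φ ∘ e, ⟨fun i => hw _, ?_, fun i => hφ _, ?_⟩, ?_⟩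
    · rw [← hw1]; exact e.sum_comp w
    · rw [← show _ = ρ from congrArg Prod.fst hx, Prod.fst_sum, ← e.sum_comp]
      exact Finset.sum_congr rfl fun i _ => by rw [← hφz]; rfl
    · rw [← show _ = x from congrArg Prod.snd hx, Prod.snd_sum, ← e.sum_comp]
      exact Finset.sum_congr rfl fun i _ => by rw [← hφz]; rfl

lemma isCompact_roofValues (hω0 : 0 < ω) (ρ : Op m n) : IsCompact (roofValues ω ρ) := by
  have hproj : Continuous fun φ : Vec m n => proj φ := by unfold proj; fun_prop
  have hK := (isCompact_setOf_isUnitVec.image_of_continuousOn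
    (hproj.continuousOn.prodMk (continuousOn_pureG (m := m) (n := n) hω0)))
      |>.convexHull_of_finiteDimensional
  have himage : roofValues ω ρ = Prod.snd '' (convexHull ℝ
      ((fun φ : Vec m n => (proj φ, pureG ω φ)) '' {φ | IsUnitVec φ}) ∩ Prod.fst ⁻¹' {ρ}) := by
    ext x
    rw [mem_roofValues_iff]
    constructor
    · exact fun h => ⟨(ρ, x), ⟨h, rfl⟩, rfl⟩
    · rintro ⟨⟨σ, y⟩, ⟨h, h1⟩, h2⟩
      cases h1; cases h2
      exact h
  rw [himage]
  exact (hK.inter_right (isClosed_singleton.preimage continuous_fst)).image continuous_snd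

lemma isLeast_gConc (hω0 : 0 < ω) {ρ : Op m n} (hρ : IsDensity ρ) :
    IsLeast (roofValues ω ρ) (gConc ω ρ) :=
  (isCompact_roofValues hω0 ρ).isLeast_sInf (roofValues_nonempty hρ)

lemma gConc_mem_roofCone (hω0 : 0 < ω) {ρ : Op m n} (hρ : IsDensity ρ) :
    (ρ, gConc ω ρ) ∈ roofCone ω m n :=
  mem_roofCone_of_roofValue (isLeast_gConc hω0 hρ).1

/-! ### Pure states -/

lemma isDensity_proj {φ : Vec m n} (hφ : IsUnitVec φ) : IsDensity (proj φ) :=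
  ⟨posSemidef_vecMulVec_self_star φ, (trace_proj φ).trans hφ⟩

/-- A pure state is an extreme point of the set of density operators. -/
lemma proj_eq_of_isPureDecomposition {N : ℕ} {φ : Vec m n} (hφ : IsUnitVec φ) {p : Fin N → ℝ}
    {χ : Fin N → Vec m n} (hd : IsPureDecomposition (proj φ) p χ) {i : Fin N} (hi : p i ≠ 0) :
    proj (χ i) = proj φ := by
  set c : Fin N → ℂ := fun j => star φ ⬝ᵥ χ j
  have hdist : ∀ j, star (χ j - c j • φ) ⬝ᵥ (χ j - c j • φ)
      = ((1 - Complex.normSq (c j) : ℝ) : ℂ) := fun j => by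
    have h1 : star (χ j) ⬝ᵥ φ = star (c j) := by
      rw [star_dotProduct]
    have h2 : star (c j) * c j = (Complex.normSq (c j) : ℂ) := by
      rw [RCLike.star_def, mul_comm, Complex.mul_conj]
    have h3 : star φ ⬝ᵥ χ j = c j := rfl
    rw [star_sub, star_smul, sub_dotProduct, dotProduct_sub, dotProduct_sub, hd.unit j,
      smul_dotProduct, smul_dotProduct, dotProduct_smul, dotProduct_smul, h1, h3,
      show star φ ⬝ᵥ φ = 1 from hφ]
    simp only [smul_eq_mul]
    push_cast
    rw [← h2]; ring
  have hle : ∀ j, 0 ≤ 1 - Complex.normSq (c j) := fun j => by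
    have := dotProduct_star_self_nonneg (χ j - c j • φ)
    rw [hdist] at this
    exact_mod_cast this
  -- Evaluating the decomposition at `φ` gives average squared overlap one, so each nonnegative
  -- defect `1 - |c j|²` of positive weight vanishes.
  have hsum : ∑ j, p j * (1 - Complex.normSq (c j)) = 0 := by
    have h1 : star φ ⬝ᵥ (proj φ *ᵥ φ) = 1 := by
      rw [proj, vecMulVec_mulVec, show star φ ⬝ᵥ φ = 1 from hφ]
      simpa using (show star φ ⬝ᵥ φ = 1 from hφ)
    have h2 : ∀ j, star φ ⬝ᵥ (((p j : ℂ) • proj (χ j)) *ᵥ φ)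
        = ((p j * Complex.normSq (c j) : ℝ) : ℂ) := fun j => by
      have h1 : star (χ j) ⬝ᵥ φ = star (c j) := by
        rw [star_dotProduct]
      rw [smul_mulVec, proj, vecMulVec_mulVec, dotProduct_smul, h1]
      simp only [dotProduct_smul, smul_eq_mul, op_smul_eq_mul]
      rw [show star φ ⬝ᵥ χ j = c j from rfl, RCLike.star_def, Complex.mul_conj]
      push_cast; ring
    have h3 : ∑ j, p j * Complex.normSq (c j) = 1 := by
      rw [hd.eq_sum, sum_mulVec, dotProduct_sum] at h1
      simp only [h2, ← Complex.ofReal_sum] at h1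
      exact_mod_cast h1
    simp only [mul_sub, mul_one, Finset.sum_sub_distrib, hd.sum_eq_one, h3, sub_self]
  have hci : 1 - Complex.normSq (c i) = 0 := by
    have := (Finset.sum_eq_zero_iff_of_nonneg fun j _ => mul_nonneg (hd.nonneg j) (hle j)).1 hsum i
      (Finset.mem_univ i)
    exact (mul_eq_zero.1 this).resolve_left hi
  have hχ : χ i = c i • φ := by
    have := hdist i
    rw [hci, Complex.ofReal_zero, dotProduct_star_self_eq_zero] at this
    exact sub_eq_zero.1 this
  rw [hχ, proj, star_smul, smul_vecMulVec, vecMulVec_smul, smul_smul, RCLike.star_def,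
    Complex.mul_conj, (sub_eq_zero.1 hci).symm, Complex.ofReal_one, one_smul, proj]

lemma gConc_proj (hω0 : 0 < ω) {φ : Vec m n} (hφ : IsUnitVec φ) :
    gConc ω (proj φ) = pureG ω φ := by
  obtain ⟨N, p, χ, hd, hx⟩ := (isLeast_gConc hω0 (isDensity_proj hφ)).1
  rw [hx]
  have : ∀ i, p i * pureG ω (χ i) = p i * pureG ω φ := fun i => by
    by_cases hi : p i = 0
    · simp [hi]
    · rw [pureG, pureG, proj_eq_of_isPureDecomposition hφ hd hi]
  simp only [this, ← Finset.sum_mul, hd.sum_eq_one, one_mul]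

/-! ### Separable states -/

/-- The product vector `u ⊗ w`. -/
def tensorVec (u : Fin m → ℂ) (w : Fin n → ℂ) : Vec m n := fun x => u x.1 * w x.2

lemma proj_tensorVec (u : Fin m → ℂ) (w : Fin n → ℂ) :
    proj (tensorVec u w) = vecMulVec u (star u) ⊗ₖ vecMulVec w (star w) := by
  ext ⟨i, j⟩ ⟨k, l⟩
  simp [proj, tensorVec, vecMulVec_apply, kroneckerMap_apply]
  ring

lemma coeffs_tensorVec (u : Fin m → ℂ) (w : Fin n → ℂ) :
    coeffs (tensorVec u w) = vecMulVec u w := rfl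

/-- The spectrum lies in `{0, 1}`, which `x ↦ x ^ ω` fixes pointwise for `ω > 0`, so the trace stays
one. -/
lemma pureG_eq_zero_of_isIdempotentElem (hω0 : 0 < ω) {φ : Vec m n} (hφ : IsUnitVec φ)
    (h : IsIdempotentElem (coeffs φ * (coeffs φ)ᴴ)) : pureG ω φ = 0 := by
  set A := coeffs φ * (coeffs φ)ᴴ
  have hA : IsDensity A := isDensity_coeffs hφ
  have hcfc : cfc (fun x : ℝ => x ^ ω) A = A := by
    conv_rhs => rw [← cfc_id' ℝ A hA.1.1.isSelfAdjoint]
    refine cfc_congr fun x hx => ?_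
    rcases h.spectrum_subset ℝ hx with rfl | rfl
    · exact Real.zero_rpow hω0.ne'
    · exact Real.one_rpow ω
  rw [pureG_eq, hcfc, hA.2]
  simp [hω0.ne']

lemma vecG_tensorVec (hω0 : 0 < ω) (u : Fin m → ℂ) (w : Fin n → ℂ) :
    vecG ω (tensorVec u w) = 0 := by
  rcases isEmpty_or_nonempty (Fin m × Fin n) with he | he
  · rw [Subsingleton.elim (tensorVec u w) 0, vecG_zero]
  obtain ⟨p, φ, hp, hφ, h⟩ := exists_normalization (tensorVec u w)
  rw [h, vecG_sqrt_smul hp, vecG_of_isUnitVec hφ]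
  rcases hp.eq_or_lt with rfl | hp
  · simp
  have hs : ((√p : ℝ) : ℂ) ≠ 0 := by exact_mod_cast (Real.sqrt_pos.2 hp).ne'
  -- The normalized vector is still a product: the scalar is absorbed into the first factor.
  have hφ' : φ = tensorVec (((√p : ℝ) : ℂ)⁻¹ • u) w := by
    rw [show tensorVec (((√p : ℝ) : ℂ)⁻¹ • u) w = ((√p : ℝ) : ℂ)⁻¹ • tensorVec u w from
      funext fun x => by simp [tensorVec, mul_assoc], h, smul_smul, inv_mul_cancel₀ hs, one_smul]
  refine mul_eq_zero_of_right _ (pureG_eq_zero_of_isIdempotentElem hω0 hφ ?_)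
  generalize ((√p : ℝ) : ℂ)⁻¹ • u = v at hφ'
  have h1 := (isDensity_coeffs hφ).2
  rw [hφ', coeffs_tensorVec, conjTranspose_vecMulVec, vecMulVec_mul_vecMulVec] at h1 ⊢
  rw [vecMulVec_smul, trace_smul, trace_vecMulVec, smul_eq_mul] at h1
  rw [IsIdempotentElem, vecMulVec_mul_vecMulVec, smul_dotProduct, dotProduct_comm (star v),
    smul_eq_mul, h1, one_smul]

lemma kronecker_mem_roofCone (hω0 : 0 < ω) {σ : Matrix (Fin m) (Fin m) ℂ}
    {τ : Matrix (Fin n) (Fin n) ℂ} (hσ : σ.PosSemidef) (hτ : τ.PosSemidef) :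
    (σ ⊗ₖ τ, 0) ∈ roofCone ω m n := by
  obtain ⟨N, u, rfl⟩ := posSemidef_iff_eq_sum_vecMulVec.1 hσ
  obtain ⟨M, w, rfl⟩ := posSemidef_iff_eq_sum_vecMulVec.1 hτ
  have h := sum_mem_roofCone (ω := ω) (s := Finset.univ)
    (ρ := fun q : Fin N × Fin M => proj (tensorVec (u q.1) (w q.2))) (x := fun _ => 0)
    fun q _ => proj_mem_roofCone (vecG_tensorVec hω0 _ _).le
  have heq : (∑ i, vecMulVec (u i) (star (u i))) ⊗ₖ (∑ j, vecMulVec (w j) (star (w j)))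
      = ∑ q : Fin N × Fin M, proj (tensorVec (u q.1) (w q.2)) := by
    simp only [proj_tensorVec, Fintype.sum_prod_type]
    ext ⟨a, b⟩ ⟨c, d⟩
    simp [Matrix.sum_apply, kroneckerMap_apply, Finset.sum_mul_sum]
  rw [heq]
  simpa using h

lemma gConc_eq_zero_of_isSeparable (hω0 : 0 < ω) (hω1 : ω ≤ 1) {ρ : Op m n}
    (h : IsSeparable ρ) : gConc ω ρ = 0 := by
  obtain ⟨N, p, σ, τ, hp, hp1, hσ, hτ, rfl⟩ := h
  refine le_antisymm (gConc_le_of_mem_roofCone hω1 ?_ ?_) (gConc_nonneg hω1 _)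
  · have := sum_mem_roofCone (ω := ω) (s := Finset.univ) (x := fun i => p i * 0)
      fun i _ => smul_mem_roofCone (hp i) (kronecker_mem_roofCone hω0 (hσ i).1 (hτ i).1)
    simpa using this
  · simp only [trace_sum, trace_smul, trace_kronecker, (hσ _).2, (hτ _).2, smul_eq_mul, mul_one]
    exact_mod_cast hp1

lemma eq_zero_or_eq_one_of_rpow_eq_self (hω : ω < 1) {x : ℝ} (hx0 : 0 ≤ x)
    (hx : x ^ ω = x) : x = 0 ∨ x = 1 := by
  by_contra! h
  have hpos := lt_of_le_of_ne hx0 (Ne.symm h.1)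
  have h1 := Real.rpow_right_inj hpos h.2 |>.1 (hx.trans (Real.rpow_one x).symm)
  exact hω.ne h1

/-- Each term of `∑ (x ^ ω - x)` over the eigenvalues is nonnegative, so all vanish. The eigenvalues
are then zeros and a single one, and the reduced state is a rank-one projection. -/
lemma exists_eq_tensorVec_of_pureG_eq_zero (hω0 : 0 < ω) (hω1 : ω < 1) {φ : Vec m n}
    (hφ : IsUnitVec φ) (h : pureG ω φ = 0) :
    ∃ (u : Fin m → ℂ) (w : Fin n → ℂ), star u ⬝ᵥ u = 1 ∧ star w ⬝ᵥ w = 1 ∧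
      φ = tensorVec u w := by
  set M := coeffs φ with hM
  set A := M * Mᴴ with hAdef
  have hA : IsDensity A := isDensity_coeffs hφ
  set l := hA.1.1.eigenvalues with hl
  rw [pureG_eq, Real.rpow_eq_zero (sub_nonneg.2 (one_le_re_trace_rpow hω1.le hA)) hω0.ne',
    hA.1.1.re_trace_cfc, ← hA.sum_eigenvalues, ← Finset.sum_sub_distrib,
    Finset.sum_eq_zero_iff_of_nonneg fun i _ => sub_nonneg.2 (le_rpow_of_le_one hω1.le
      (hA.1.eigenvalues_nonneg i) (hA.eigenvalues_le_one i))] at h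
  have h01 : ∀ i, l i = 0 ∨ l i = 1 := fun i =>
    eq_zero_or_eq_one_of_rpow_eq_self hω1 (hA.1.eigenvalues_nonneg i)
      (sub_eq_zero.1 (h i (Finset.mem_univ i)))
  obtain ⟨k, hk⟩ : ∃ k, l k = 1 := by
    by_contra! hne
    have := hA.sum_eigenvalues
    rw [Finset.sum_eq_zero fun i _ => (h01 i).resolve_right (hne i)] at this
    exact zero_ne_one this
  have hl1 : l = Pi.single k 1 := by
    funext i
    by_cases hi : i = k
    · rw [hi, hk, Pi.single_eq_same]
    · rw [Pi.single_eq_of_ne hi]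
      refine (h01 i).resolve_right fun h1 => ?_
      have h2 := Finset.add_le_sum (s := Finset.univ) (f := l)
        (fun j _ => hA.1.eigenvalues_nonneg j) (Finset.mem_univ i) (Finset.mem_univ k) hi
      rw [h1, hk, hA.sum_eigenvalues] at h2
      norm_num at h2
  set u : Fin m → ℂ := fun i => (hA.1.1.eigenvectorUnitary : Matrix (Fin m) (Fin m) ℂ) i k
  have hu : star u ⬝ᵥ u = 1 := by
    have := congrFun (congrFun (mem_unitaryGroup_iff'.1 hA.1.1.eigenvectorUnitary.2) k) k
    rw [mul_apply, one_apply_eq] at this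
    exact this
  have hAu : A = vecMulVec u (star u) := by
    conv_lhs => rw [hA.1.1.spectral_theorem, Unitary.conjStarAlgAut_apply]
    rw [← hl, hl1]
    ext i j
    rw [mul_apply, vecMulVec_apply, Finset.sum_eq_single k]
    · simp [u]
    · intro b _ hb
      simp [hb]
    · simp
  set w : Fin n → ℂ := star u ᵥ* M
  have hMu : M = vecMulVec u w := by
    -- With `P = vecMulVec u (star u) = M Mᴴ`, the product `(M - P M)(M - P M)ᴴ` expands to `P - P²
    -- - P² + P³ = 0`.
    have hzero : (M - vecMulVec u w) * (M - vecMulVec u w)ᴴ = 0 := by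
      have hw : vecMulVec u w = vecMulVec u (star u) * M := (vecMulVec_mul _ _ _).symm
      have hidem : vecMulVec u (star u) * vecMulVec u (star u) = vecMulVec u (star u) := by
        rw [vecMulVec_mul_vecMulVec, hu, vecMulVec_smul, one_smul]
      have hself : (vecMulVec u (star u))ᴴ = vecMulVec u (star u) := by
        rw [conjTranspose_vecMulVec, star_star]
      rw [hw, conjTranspose_sub, conjTranspose_mul, hself, Matrix.sub_mul, Matrix.mul_sub,
        Matrix.mul_sub, ← Matrix.mul_assoc M, Matrix.mul_assoc _ M Mᴴ,
        Matrix.mul_assoc _ M (Mᴴ * _), ← Matrix.mul_assoc M, ← hAdef, hAu]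
      simp [hidem]
    exact sub_eq_zero.1 (self_mul_conjTranspose_eq_zero.1 hzero)
  have hφt : φ = tensorVec u w := by
    funext ⟨i, j⟩
    exact congrFun (congrFun hMu i) j
  refine ⟨u, w, hu, ?_, hφt⟩
  have h1 := hA.2
  rw [hAdef, hMu, conjTranspose_vecMulVec, vecMulVec_mul_vecMulVec, vecMulVec_smul, trace_smul,
    trace_vecMulVec, dotProduct_comm u, hu, smul_eq_mul, mul_one, dotProduct_comm] at h1
  exact h1

lemma isDensity_vecMulVec {k : ℕ} {u : Fin k → ℂ} (hu : star u ⬝ᵥ u = 1) :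
    IsDensity (vecMulVec u (star u)) :=
  ⟨posSemidef_vecMulVec_self_star u, by rw [trace_vecMulVec, dotProduct_comm, hu]⟩

lemma isSeparable_of_gConc_eq_zero (hω0 : 0 < ω) (hω1 : ω < 1) {ρ : Op m n} (hρ : IsDensity ρ)
    (h : gConc ω ρ = 0) : IsSeparable ρ := by
  obtain ⟨N, p, φ, hd, hx⟩ := (isLeast_gConc hω0 hρ).1
  rw [h, eq_comm, Finset.sum_eq_zero_iff_of_nonneg fun i _ =>
    mul_nonneg (hd.nonneg i) (pureG_nonneg hω1.le (hd.unit i))] at hx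
  have key : ∀ i, ∃ (σ : Matrix (Fin m) (Fin m) ℂ) (τ : Matrix (Fin n) (Fin n) ℂ),
      IsDensity σ ∧ IsDensity τ ∧ (p i : ℂ) • proj (φ i) = (p i : ℂ) • (σ ⊗ₖ τ) := fun i => by
    by_cases hp : p i = 0
    -- A term of weight zero says nothing about its vector, so any product state serves.
    · obtain ⟨a, b⟩ := (nonempty_of_trace_eq_one hρ.2).some
      exact ⟨_, _, isDensity_vecMulVec (u := Pi.single a 1) (by simp),
        isDensity_vecMulVec (u := Pi.single b 1) (by simp), by simp [hp]⟩
    · obtain ⟨u, w, hu, hw, hφ⟩ := exists_eq_tensorVec_of_pureG_eq_zero hω0 hω1 (hd.unit i)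
        ((mul_eq_zero.1 (hx i (Finset.mem_univ i))).resolve_left hp)
      exact ⟨_, _, isDensity_vecMulVec hu, isDensity_vecMulVec hw, by rw [hφ, proj_tensorVec]⟩
  choose σ τ hσ hτ hστ using key
  exact ⟨N, p, σ, τ, hd.nonneg, hd.sum_eq_one, hσ, hτ,
    hd.eq_sum.trans (Finset.sum_congr rfl fun i _ => hστ i)⟩

/-! ### Local unitaries and mixing -/

/-- The protocol in which the two parties apply local unitaries. -/
def localUnitary {U : Matrix (Fin m) (Fin m) ℂ} {V : Matrix (Fin n) (Fin n) ℂ}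
    (hU : U ∈ unitaryGroup (Fin m) ℂ) (hV : V ∈ unitaryGroup (Fin n) ℂ) : LOCC Unit m n m n :=
  .alice (fun _ : Fin 1 => U) (by simpa [star_eq_conjTranspose] using mem_unitaryGroup_iff'.1 hU) fun _ =>
    .bob (fun _ : Fin 1 => V) (by simpa [star_eq_conjTranspose] using mem_unitaryGroup_iff'.1 hV) fun _ => .finish ()

lemma channel_localUnitary {U : Matrix (Fin m) (Fin m) ℂ} {V : Matrix (Fin n) (Fin n) ℂ}
    (hU : U ∈ unitaryGroup (Fin m) ℂ) (hV : V ∈ unitaryGroup (Fin n) ℂ) (ρ : Op m n) :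
    (localUnitary hU hV).channel ρ = (U ⊗ₖ V) * ρ * (U ⊗ₖ V)ᴴ := by
  have h : U ⊗ₖ V = ((1 : Matrix (Fin m) (Fin m) ℂ) ⊗ₖ V) *
      (U ⊗ₖ (1 : Matrix (Fin n) (Fin n) ℂ)) := by
    rw [← mul_kronecker_mul, Matrix.one_mul, Matrix.mul_one]
  rw [h, conjTranspose_mul]
  simp [localUnitary, LOCC.channel, LOCC.branch, Matrix.mul_assoc]

lemma gConc_local_unitary_le (hω0 : 0 < ω) (hω1 : ω ≤ 1) {U : Matrix (Fin m) (Fin m) ℂ}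
    {V : Matrix (Fin n) (Fin n) ℂ} (hU : U ∈ unitaryGroup (Fin m) ℂ)
    (hV : V ∈ unitaryGroup (Fin n) ℂ) {ρ : Op m n} (hρ : IsDensity ρ) :
    gConc ω ((U ⊗ₖ V) * ρ * (U ⊗ₖ V)ᴴ) ≤ gConc ω ρ := by
  rw [← channel_localUnitary hU hV]
  exact LOCC.gConc_channel_le_of_mem_roofCone hω0 hω1 _ hρ.2 (gConc_mem_roofCone hω0 hρ)

lemma gConc_local_unitary (hω0 : 0 < ω) (hω1 : ω ≤ 1) {U : Matrix (Fin m) (Fin m) ℂ}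
    {V : Matrix (Fin n) (Fin n) ℂ} (hU : U ∈ unitaryGroup (Fin m) ℂ)
    (hV : V ∈ unitaryGroup (Fin n) ℂ) {ρ : Op m n} (hρ : IsDensity ρ) :
    gConc ω ((U ⊗ₖ V) * ρ * (U ⊗ₖ V)ᴴ) = gConc ω ρ := by
  refine le_antisymm (gConc_local_unitary_le hω0 hω1 hU hV hρ) ?_
  have hUV : (U ⊗ₖ V)ᴴ * (U ⊗ₖ V) = 1 := by
    rw [conjTranspose_kronecker, ← mul_kronecker_mul, ← star_eq_conjTranspose,
      ← star_eq_conjTranspose, mem_unitaryGroup_iff'.1 hU, mem_unitaryGroup_iff'.1 hV,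
      one_kronecker_one]
  have hσ : IsDensity ((U ⊗ₖ V) * ρ * (U ⊗ₖ V)ᴴ) :=
    ⟨hρ.1.mul_mul_conjTranspose_same _, by rw [trace_mul_cycle, hUV, Matrix.one_mul, hρ.2]⟩
  -- Monotonicity under the inverse unitaries gives the reverse inequality.
  have h := gConc_local_unitary_le hω0 hω1 (Unitary.star_mem hU) (Unitary.star_mem hV) hσ
  rwa [star_eq_conjTranspose, star_eq_conjTranspose, ← conjTranspose_kronecker,
    conjTranspose_conjTranspose, Matrix.mul_assoc, Matrix.mul_assoc, hUV, Matrix.mul_one,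
    ← Matrix.mul_assoc, hUV, Matrix.one_mul] at h

lemma gConc_convex (hω0 : 0 < ω) (hω1 : ω ≤ 1) {N : ℕ} {p : Fin N → ℝ} {ρ : Fin N → Op m n}
    (hp : ∀ i, 0 ≤ p i) (hp1 : ∑ i, p i = 1) (hρ : ∀ i, IsDensity (ρ i)) :
    gConc ω (∑ i, (p i : ℂ) • ρ i) ≤ ∑ i, p i * gConc ω (ρ i) := by
  refine gConc_le_of_mem_roofCone hω1 (sum_mem_roofCone fun i _ =>
    smul_mem_roofCone (hp i) (gConc_mem_roofCone hω0 (hρ i))) ?_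
  simp only [trace_sum, trace_smul, (hρ _).2, smul_eq_mul, mul_one]
  exact_mod_cast hp1

end GConcurrence
end

theorem mainTheorem2 (ω : ℝ) (hω0 : 0 < ω) (hω1 : ω ≤ 1) :
    -- the minimum that defines the measure is attained, and it extends the pure-state formula
    (∀ (m n : ℕ) (ρ : Op m n), IsDensity ρ → IsLeast (roofValues ω ρ) (gConc ω ρ)) ∧
    (∀ (m n : ℕ) (φ : Vec m n), IsUnitVec φ → gConc ω (proj φ) = pureG ω φ) ∧
    -- (i) nonnegativity and faithfulness
    (∀ (m n : ℕ) (ρ : Op m n), IsDensity ρ → 0 ≤ gConc ω ρ) ∧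
    (∀ (m n : ℕ) (ρ : Op m n), IsSeparable ρ → gConc ω ρ = 0) ∧
    (ω < 1 → ∀ (m n : ℕ) (ρ : Op m n), IsDensity ρ → (gConc ω ρ = 0 ↔ IsSeparable ρ)) ∧
    -- (ii) monotonicity under LOCC channels
    (∀ (ι : Type) [Fintype ι] [DecidableEq ι] (m n m' n' : ℕ) (P : LOCC ι m' n' m n)
      (ρ : Op m n), IsDensity ρ → gConc ω (P.channel ρ) ≤ gConc ω ρ) ∧
    -- (iii) invariance under local unitaries
    (∀ (m n : ℕ) (ρ : Op m n), IsDensity ρ →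
      ∀ U ∈ Matrix.unitaryGroup (Fin m) ℂ, ∀ V ∈ Matrix.unitaryGroup (Fin n) ℂ,
        gConc ω ((U ⊗ₖ V) * ρ * (U ⊗ₖ V).conjTranspose) = gConc ω ρ) ∧
    -- (iv) strong monotonicity: no increase on average over the outcomes of LOCC
    (∀ (ι : Type) [Fintype ι] [DecidableEq ι] (m n m' n' : ℕ) (P : LOCC ι m' n' m n)
      (ρ : Op m n), IsDensity ρ →
        ∑ j, P.prob ρ j * gConc ω (P.post ρ j) ≤ gConc ω ρ) ∧
    -- (v) convexity
    (∀ (m n N : ℕ) (p : Fin N → ℝ) (ρ : Fin N → Op m n),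
      (∀ i, 0 ≤ p i) → ∑ i, p i = 1 → (∀ i, IsDensity (ρ i)) →
        gConc ω (∑ i, (p i : ℂ) • ρ i) ≤ ∑ i, p i * gConc ω (ρ i)) :=
  ⟨fun _ _ _ hρ => isLeast_gConc hω0 hρ,
    fun _ _ _ hφ => gConc_proj hω0 hφ,
    fun _ _ ρ _ => gConc_nonneg hω1 ρ,
    fun _ _ _ h => gConc_eq_zero_of_isSeparable hω0 hω1 h,
    fun hω _ _ _ hρ => ⟨isSeparable_of_gConc_eq_zero hω0 hω hρ,
      gConc_eq_zero_of_isSeparable hω0 hω1⟩,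
    fun _ _ _ _ _ _ _ P _ hρ =>
      P.gConc_channel_le_of_mem_roofCone hω0 hω1 hρ.2 (gConc_mem_roofCone hω0 hρ),
    fun _ _ _ hρ _ hU _ hV => gConc_local_unitary hω0 hω1 hU hV hρ,
    fun _ _ _ _ _ _ _ P _ hρ =>
      P.sum_prob_mul_gConc_post_le_of_mem_roofCone hω0 hω1 (gConc_mem_roofCone hω0 hρ),
    fun _ _ _ _ _ hp hp1 hρ => gConc_convex hω0 hω1 hp hp1 hρ⟩
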